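/- For a positive integer $\ell$ let $b_\ell(n)$ denote the number of $\ell$-regular partitions of $n$, that is, partitions of $n$ none of whose parts is divisible by $\ell$, with $b_\ell(0)=1$ and $b_\ell(n)=0$ for $n<0$. Let $\alpha$ and $n$ be nonnegative integers, and let $p_1,\dots,p_{\alpha+1}$ be (not necessarily distinct) primes with $p_i\ge 5$ and $p_i\equiv 3 \pmod 4$ for every $i$. Then for every integer $j$ with $j\not\equiv 0 \pmod{p_{\alpha+1}}$, the number $p_1^2\cdots p_\alpha^2\,p_{\alpha+1}(12j+5p_{\alpha+1})-5$ is divisible by $12$ and $$b_{11}\left(p_1^2\cdots p_{\alpha+1}^2\,n+\frac{p_1^2\cdots p_\alpha^2\,p_{\alpha+1}(12j+5p_{\alpha+1})-5}{12}\right)\equiv 0 \pmod{11}.$$ -/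

import Mathlib

/-- `regularPartitionCount ℓ n` is `b_ℓ(n)`: the number of partitions of `n` none of whose parts
is divisible by `ℓ`, and `0` when `n` is negative. -/
def regularPartitionCount (ℓ : ℕ) (n : ℤ) : ℕ :=
  if 0 ≤ n then (Nat.Partition.restricted n.toNat (fun k => ¬ ℓ ∣ k)).card else 0

/-! Write f = ∏ (1 - X^i). By Glaisher's bijection the generating function of b_11 is ∏ (1 + X^i + ⋯
+ X^(10i)), which is f^10 modulo 11. So it suffices that the coefficient of X^m in f^10 vanishes
when 24m + 10 is not a sum of two squares. In the theorem 24m + 10 = A²Pu with P ≡ 3 mod 4 prime and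
P ∤ u, so P divides it to an odd power.

For the vanishing, let E = X f(X^24), a theta series by the pentagonal number theorem. Jacobi's
identity for f^3 makes 2E^3 a theta series J with a linear weight. Changes of variables in binary
quadratic forms give a 2 × 2 matrix identity whose determinant reads 6 J^4 = E^2 · S
(`theta_fourth_power`), where S is a combination of products of two series in the X^(x²). Hence 96
E^10 = S is supported on sums of two squares.

Jacobi's identity is the limit of a finite form, obtained by differentiating the q-binomial theorem.
-/

open PowerSeries

/-! ### Formal power series indexed by arbitrary types -/

/-- A function to `ℕ` each of whose fibers is finite. -/
def FiniteFibers {ι : Type*} (e : ι → ℕ) : Prop := ∀ n, {i | e i = n}.Finite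

/-- The formal power series `∑ i, w i * X ^ e i`, meaningful when `e` has finite fibers. -/
noncomputable def indexedSeries {ι : Type*} (e : ι → ℕ) (w : ι → ℤ) : ℤ⟦X⟧ :=
  PowerSeries.mk fun n => ∑ᶠ i ∈ {i | e i = n}, w i

namespace indexedSeries

variable {ι κ : Type*}

theorem coeff_eq_sum {e : ι → ℕ} (he : FiniteFibers e) (w : ι → ℤ) (n : ℕ) :
    coeff n (indexedSeries e w) = ∑ i ∈ (he n).toFinset, w i := by
  rw [indexedSeries, coeff_mk, finsum_mem_eq_finite_toFinset_sum]

theorem finite_le {e : ι → ℕ} (he : FiniteFibers e) (n : ℕ) : {i | e i ≤ n}.Finite := by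
  have : {i | e i ≤ n} = ⋃ m ∈ Set.Iic n, {i | e i = m} := by ext; simp
  rw [this]
  exact (Set.finite_Iic n).biUnion fun m _ => he m

theorem finiteFibers_prod {e : ι → ℕ} {e' : κ → ℕ} (he : FiniteFibers e) (he' : FiniteFibers e') :
    FiniteFibers (fun x : ι × κ => e x.1 + e' x.2) := by
  intro n
  refine ((finite_le he n).prod (finite_le he' n)).subset ?_
  rintro ⟨i, j⟩ hij
  simp only [Set.mem_ofPred_eq, Set.mem_prod] at hij ⊢
  omega

theorem mul {e : ι → ℕ} {e' : κ → ℕ} (he : FiniteFibers e) (he' : FiniteFibers e')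
    (w : ι → ℤ) (w' : κ → ℤ) :
    indexedSeries e w * indexedSeries e' w' =
      indexedSeries (fun x : ι × κ => e x.1 + e' x.2) (fun x => w x.1 * w' x.2) := by
  classical
  ext n
  rw [coeff_eq_sum (finiteFibers_prod he he'), coeff_mul,
    ← Finset.sum_fiberwise_of_maps_to (t := Finset.HasAntidiagonal.antidiagonal n)
      (g := fun x : ι × κ => (e x.1, e' x.2)) (by simp)]
  refine Finset.sum_congr rfl ?_
  rintro ⟨a, b⟩ hab
  rw [Finset.HasAntidiagonal.mem_antidiagonal] at hab
  rw [coeff_eq_sum he, coeff_eq_sum he', Finset.sum_mul_sum, ← Finset.sum_product']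
  refine Finset.sum_congr ?_ fun _ _ => rfl
  ext ⟨i, j⟩
  simp only [Finset.mem_product, Set.Finite.mem_toFinset, Set.mem_ofPred_eq, Finset.mem_filter,
    Prod.mk.injEq] at hab ⊢
  omega

/-- Reindexing along an injection whose range contains the support of the weight. -/
theorem comp_injective (e : ι → ℕ) (w : ι → ℤ) {j : κ → ι} (hj : Function.Injective j)
    (hw : ∀ i, w i ≠ 0 → i ∈ Set.range j) :
    indexedSeries (e ∘ j) (w ∘ j) = indexedSeries e w := by
  ext n
  rw [indexedSeries, indexedSeries, coeff_mk, coeff_mk,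
    ← finsum_mem_inter_support w {i | e i = n}]
  have : {i | e i = n} ∩ Function.support w =
      j '' ({k | (e ∘ j) k = n} ∩ Function.support (w ∘ j)) := by
    ext i
    constructor
    · rintro ⟨h1, h2⟩
      obtain ⟨k, rfl⟩ := hw i h2
      exact ⟨k, ⟨h1, h2⟩, rfl⟩
    · rintro ⟨k, ⟨h1, h2⟩, rfl⟩
      exact ⟨h1, h2⟩
  rw [this, finsum_mem_image hj.injOn, ← finsum_mem_inter_support (w ∘ j)]
  rfl

theorem add {e : ι → ℕ} (he : FiniteFibers e) (w w' : ι → ℤ) :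
    indexedSeries e (fun i => w i + w' i) = indexedSeries e w + indexedSeries e w' := by
  ext n
  simp only [map_add, coeff_eq_sum he, Finset.sum_add_distrib]

theorem const_mul {e : ι → ℕ} (he : FiniteFibers e) (c : ℤ) (w : ι → ℤ) :
    indexedSeries e (fun i => c * w i) = C c * indexedSeries e w := by
  ext n
  simp only [coeff_C_mul, coeff_eq_sum he, Finset.mul_sum]

theorem coeff_eq_zero {e : ι → ℕ} (w : ι → ℤ) {n : ℕ} (h : ∀ i, e i ≠ n) :
    coeff n (indexedSeries e w) = 0 := by
  rw [indexedSeries, coeff_mk]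
  exact finsum_mem_eq_zero_of_forall_eq_zero fun i hi => absurd hi (h i)

theorem X_pow_mul_expand (a d : ℕ) (hd : d ≠ 0) (e : ι → ℕ) (w : ι → ℤ) :
    X ^ a * PowerSeries.expand d hd (indexedSeries e w) =
      indexedSeries (fun i => d * e i + a) w := by
  ext n
  rw [coeff_X_pow_mul']
  by_cases h : ∃ m, n = d * m + a
  · obtain ⟨m, rfl⟩ := h
    rw [if_pos (by omega), Nat.add_sub_cancel, coeff_expand_mul, indexedSeries, indexedSeries,
      coeff_mk, coeff_mk]
    congr! 3 with i
    simp [hd]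
  · rw [coeff_eq_zero w fun i hi => h ⟨_, hi.symm⟩]
    split_ifs with ha
    · rw [coeff_expand_of_not_dvd]
      rintro ⟨m, hm⟩
      exact h ⟨m, by omega⟩
    · rfl

end indexedSeries

theorem finiteFibers_sq (c : ℕ) (hc : c ≠ 0) : FiniteFibers (fun x : ℤ => c * x.natAbs ^ 2) := by
  intro n
  refine (Set.finite_Icc (-(n : ℤ)) n).subset fun x hx => ?_
  simp only [Set.mem_ofPred_eq, Set.mem_Icc] at hx ⊢
  have h1 : x.natAbs ≤ x.natAbs ^ 2 := Nat.le_self_pow two_ne_zero _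
  have h2 : x.natAbs ^ 2 ≤ c * x.natAbs ^ 2 := Nat.le_mul_of_pos_left _ (Nat.pos_of_ne_zero hc)
  omega

/-! ### Gaussian binomials and the finite Jacobi identity -/

/-- The Gaussian binomial coefficient, evaluated at an element `q` of a commutative ring. -/
def gaussBinom {A : Type*} [CommRing A] (q : A) : ℕ → ℕ → A
  | _, 0 => 1
  | 0, _ + 1 => 0
  | n + 1, k + 1 => gaussBinom q n k + q ^ (k + 1) * gaussBinom q n (k + 1)

/-- The finite product `(1 - q) (1 - q ^ 2) ⋯ (1 - q ^ n)`. -/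
def eulerProd {A : Type*} [CommRing A] (q : A) (n : ℕ) : A :=
  ∏ i ∈ Finset.range n, (1 - q ^ (i + 1))

section GaussBinom

variable {A : Type*} [CommRing A] (q : A)

theorem gaussBinom_zero_right (n : ℕ) : gaussBinom q n 0 = 1 := by
  cases n <;> rfl

theorem gaussBinom_succ_succ (n k : ℕ) :
    gaussBinom q (n + 1) (k + 1) = gaussBinom q n k + q ^ (k + 1) * gaussBinom q n (k + 1) := rfl

theorem gaussBinom_eq_zero {n k : ℕ} (h : n < k) : gaussBinom q n k = 0 := by
  induction n generalizing k with
  | zero =>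
    obtain ⟨k, rfl⟩ := Nat.exists_eq_succ_of_ne_zero h.ne'
    rfl
  | succ n ih =>
    obtain ⟨k, rfl⟩ := Nat.exists_eq_succ_of_ne_zero (Nat.ne_zero_of_lt h)
    rw [Nat.succ_eq_add_one, gaussBinom_succ_succ, ih (by omega), ih (by omega)]
    ring

theorem gaussBinom_self (n : ℕ) : gaussBinom q n n = 1 := by
  induction n with
  | zero => rfl
  | succ n ih => rw [gaussBinom_succ_succ, ih, gaussBinom_eq_zero q (Nat.lt_succ_self n)]; ring

theorem eulerProd_succ (n : ℕ) : eulerProd q (n + 1) = eulerProd q n * (1 - q ^ (n + 1)) :=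
  Finset.prod_range_succ _ _

/-- The q-factorial quotient formula without division. The inductive step is Pascal's rule together
with 1 - q^(k+m+2) = (1 - q^(k+1)) + q^(k+1) (1 - q^(m+1)). -/
theorem gaussBinom_mul_eulerProd (m k : ℕ) :
    gaussBinom q (m + k) k * eulerProd q k * eulerProd q m = eulerProd q (m + k) := by
  induction k generalizing m with
  | zero => simp [gaussBinom_zero_right, eulerProd]
  | succ k ihk =>
    induction m with
    | zero => simp [gaussBinom_self, eulerProd]
    | succ m ihm =>
      have h1 := ihk (m + 1)
      rw [show m + 1 + k = m + (k + 1) by ring] at h1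
      rw [show m + 1 + (k + 1) = m + (k + 1) + 1 by ring, gaussBinom_succ_succ,
        eulerProd_succ q (m + (k + 1))]
      have e1 := eulerProd_succ q k
      have e2 := eulerProd_succ q m
      rw [show m + (k + 1) + 1 = (k + 1) + (m + 1) by ring, pow_add q (k + 1) (m + 1)]
      linear_combination (1 - q ^ (k + 1)) * h1 + q ^ (k + 1) * (1 - q ^ (m + 1)) * ihm +
        gaussBinom q (m + (k + 1)) k * eulerProd q (m + 1) * e1 +
        q ^ (k + 1) * gaussBinom q (m + (k + 1)) (k + 1) * eulerProd q (k + 1) * e2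

/-- The `q`-binomial theorem. -/
theorem prod_add_mul_pow {B : Type*} [CommRing B] (φ : A →+* B) (a : A) (b : B) (n : ℕ) :
    ∏ i ∈ Finset.range n, (φ a + φ q ^ i * b) =
      ∑ k ∈ Finset.range (n + 1),
        φ (q ^ k.choose 2 * gaussBinom q n k * a ^ (n - k)) * b ^ k := by
  induction n generalizing b with
  | zero => simp [gaussBinom_zero_right]
  | succ n ih =>
    -- The factor i = 0 is split off; the others form the product of length n at φ q * b.
    rw [Finset.prod_range_succ']
    have h : ∀ i, φ a + φ q ^ (i + 1) * b = φ a + φ q ^ i * (φ q * b) := fun i => by ring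
    simp only [h, ih]
    rw [Finset.sum_mul, Finset.sum_range_succ' _ (n + 1)]
    have h1 : ∀ k ∈ Finset.range (n + 1),
        φ (q ^ (k + 1).choose 2 * gaussBinom q (n + 1) (k + 1) * a ^ (n + 1 - (k + 1))) *
          b ^ (k + 1) =
        φ (q ^ k.choose 2 * gaussBinom q n k * a ^ (n - k)) * (φ q * b) ^ k * b +
        φ (q ^ (k + 1).choose 2 * q ^ (k + 1) * gaussBinom q n (k + 1) * a ^ (n - k)) *
          b ^ (k + 1) := by
      intro k _
      rw [gaussBinom_succ_succ, Nat.choose_succ_succ' k 1, Nat.choose_one_right,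
        Nat.add_sub_add_right]
      simp only [map_mul, map_add, map_pow]
      ring
    have h2 : ∑ k ∈ Finset.range (n + 1),
        φ (q ^ (k + 1).choose 2 * q ^ (k + 1) * gaussBinom q n (k + 1) * a ^ (n - k)) *
          b ^ (k + 1) +
        φ (q ^ (0).choose 2 * gaussBinom q (n + 1) 0 * a ^ (n + 1 - 0)) * b ^ 0 =
        ∑ k ∈ Finset.range (n + 1),
          φ (q ^ k.choose 2 * gaussBinom q n k * a ^ (n - k)) * (φ q * b) ^ k * φ a := by
      rw [Finset.sum_range_succ, gaussBinom_eq_zero q (Nat.lt_succ_self n),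
        Finset.sum_range_succ' _ n]
      simp only [gaussBinom_zero_right, mul_zero, zero_mul, map_zero, add_zero]
      congr 1
      · refine Finset.sum_congr rfl fun k hk => ?_
        have : n - k = n - (k + 1) + 1 := by
          have := Finset.mem_range.mp hk
          omega
        rw [this]
        simp only [map_mul, map_pow]
        ring
      · simp [pow_succ]
    rw [Finset.sum_congr rfl h1, Finset.sum_add_distrib, add_assoc, h2, ← Finset.sum_add_distrib]
    refine Finset.sum_congr rfl fun k _ => ?_
    ring

theorem prod_pow_sub_pow (N : ℕ) :
    ∏ i ∈ Finset.range N, (q ^ N - q ^ i) = (-1) ^ N * q ^ N.choose 2 * eulerProd q N := by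
  rw [← Finset.prod_range_reflect, eulerProd]
  have h : ∀ i ∈ Finset.range N, q ^ N - q ^ (N - 1 - i) =
      (-1) * q ^ (N - 1 - i) * (1 - q ^ (i + 1)) := by
    intro i hi
    have hi := Finset.mem_range.mp hi
    have : q ^ N = q ^ (N - 1 - i) * q ^ (i + 1) := by
      rw [← pow_add]
      congr 1
      omega
    rw [this]
    ring
  rw [Finset.prod_congr rfl h, Finset.prod_mul_distrib, Finset.prod_mul_distrib,
    Finset.prod_const, Finset.card_range, Finset.prod_range_reflect (fun i => q ^ i),
    Finset.prod_pow_eq_pow_sum, Finset.sum_range_id, Nat.choose_two_right]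

/-- A finite form of Jacobi's identity for the cube of the Euler product. -/
theorem sum_gaussBinom_odd (N : ℕ) :
    ∑ k ∈ Finset.range (2 * N + 2), (-1) ^ k * (2 * (k : A) - (2 * N + 1)) *
        (q ^ (k.choose 2 + N * (2 * N + 1 - k)) * gaussBinom q (2 * N + 1) k) =
      -2 * (-1) ^ N * q ^ (N + N.choose 2 + N * N) * eulerProd q N ^ 2 := by
  -- With a = q^N and b = -X the middle factor i = N is q^N (1 - X). At X = 1 the product therefore
  -- vanishes, and its derivative is -q^N times the values of the two outer blocks.
  have key := prod_add_mul_pow q (Polynomial.C (R := A)) (q ^ N) (-Polynomial.X) (2 * N + 1)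
  set P₁ : Polynomial A := ∏ i ∈ Finset.range N, (Polynomial.C (q ^ N) +
    Polynomial.C q ^ i * -Polynomial.X) with hP₁
  set P₂ : Polynomial A := ∏ i ∈ Finset.range N, (Polynomial.C (q ^ N) +
    Polynomial.C q ^ (N + 1 + i) * -Polynomial.X) with hP₂
  have hprod : ∏ i ∈ Finset.range (2 * N + 1), (Polynomial.C (q ^ N) +
      Polynomial.C q ^ i * -Polynomial.X) =
      P₁ * (Polynomial.C (q ^ N) * (1 - Polynomial.X)) * P₂ := by
    rw [show 2 * N + 1 = N + 1 + N by ring, Finset.prod_range_add, Finset.prod_range_succ]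
    congr 2
    rw [map_pow]
    ring
  rw [hprod] at key
  have hv₁ : P₁.eval 1 = (-1) ^ N * q ^ N.choose 2 * eulerProd q N := by
    rw [← prod_pow_sub_pow, hP₁, Polynomial.eval_prod]
    refine Finset.prod_congr rfl fun i _ => ?_
    simp [sub_eq_add_neg]
  have hv₂ : P₂.eval 1 = q ^ (N * N) * eulerProd q N := by
    rw [hP₂, Polynomial.eval_prod, eulerProd, pow_mul]
    have : (q ^ N) ^ N = ∏ i ∈ Finset.range N, q ^ N := by simp
    rw [this, ← Finset.prod_mul_distrib]
    refine Finset.prod_congr rfl fun i _ => ?_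
    simp only [Polynomial.eval_add, Polynomial.eval_C, Polynomial.eval_mul, Polynomial.eval_pow,
      Polynomial.eval_neg, Polynomial.eval_X]
    ring
  have hzero := congrArg (Polynomial.eval 1) key
  have hder := congrArg (fun p => Polynomial.eval 1 (Polynomial.derivative p)) key
  simp only [Polynomial.eval_mul, Polynomial.eval_sub, Polynomial.eval_one, Polynomial.eval_X,
    sub_self, mul_zero, zero_mul, Polynomial.eval_finsetSum, Polynomial.eval_C,
    Polynomial.eval_pow, Polynomial.eval_neg] at hzero
  simp only [Polynomial.derivative_mul, Polynomial.derivative_C, Polynomial.derivative_sub,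
    Polynomial.derivative_one, Polynomial.derivative_X, Polynomial.eval_add, Polynomial.eval_mul,
    Polynomial.eval_sub, Polynomial.eval_one, Polynomial.eval_X,
    Polynomial.eval_C, Polynomial.derivative_sum, Polynomial.eval_finsetSum,
    Polynomial.derivative_pow, Polynomial.derivative_neg, Polynomial.eval_pow,
    Polynomial.eval_neg, hv₁, hv₂, sub_self, mul_zero, zero_mul, zero_add, add_zero,
    zero_sub] at hder
  -- The weight 2k - (2N + 1) is twice the derivative at 1 minus 2N + 1 times the value, which is
  -- zero.
  have hterm : ∀ k ∈ Finset.range (2 * N + 2), (-1) ^ k * (2 * (k : A) - (2 * N + 1)) *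
        (q ^ (k.choose 2 + N * (2 * N + 1 - k)) * gaussBinom q (2 * N + 1) k) =
      2 * (q ^ k.choose 2 * gaussBinom q (2 * N + 1) k * (q ^ N) ^ (2 * N + 1 - k) *
        ((k : A) * (-1) ^ (k - 1) * -1)) -
      (2 * N + 1) * (q ^ k.choose 2 * gaussBinom q (2 * N + 1) k * (q ^ N) ^ (2 * N + 1 - k) *
        (-1) ^ k) := by
    intro k _
    rcases k with - | k
    · rw [pow_add, pow_mul]
      simp
      ring
    · rw [pow_add q, pow_mul q, Nat.add_sub_cancel, pow_succ (-1 : A) k]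
      ring
  rw [Finset.sum_congr rfl hterm, Finset.sum_sub_distrib, ← Finset.mul_sum, ← Finset.mul_sum,
    ← hzero, mul_zero, sub_zero]
  rw [← hder, pow_add, pow_add]
  ring

end GaussBinom

/-! ### Unary and binary theta series, and linear substitutions -/

/-- The theta series `∑ x : ℤ, s x * x ^ k * X ^ (c * x ^ 2)`, the sign `s` depending on `x`
modulo `12`. -/
noncomputable def thetaSeries (c : ℕ) (s : ZMod 12 → ℤ) (k : ℕ) : ℤ⟦X⟧ :=
  indexedSeries (fun x : ℤ => c * x.natAbs ^ 2) (fun x => s x * x ^ k)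

/-- The binary theta series `∑ (x, y) : ℤ × ℤ, s x y * f x y * X ^ (c * x ^ 2 + d * y ^ 2)`. -/
noncomputable def binaryTheta (c d : ℕ) (s : ZMod 12 → ZMod 12 → ℤ) (f : ℤ → ℤ → ℤ) : ℤ⟦X⟧ :=
  indexedSeries (fun x : ℤ × ℤ => c * x.1.natAbs ^ 2 + d * x.2.natAbs ^ 2)
    (fun x => s x.1 x.2 * f x.1 x.2)

theorem finiteFibers_binary {c d : ℕ} (hc : c ≠ 0) (hd : d ≠ 0) :
    FiniteFibers (fun x : ℤ × ℤ => c * x.1.natAbs ^ 2 + d * x.2.natAbs ^ 2) :=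
  indexedSeries.finiteFibers_prod (finiteFibers_sq c hc) (finiteFibers_sq d hd)

theorem thetaSeries_mul {c d : ℕ} (hc : c ≠ 0) (hd : d ≠ 0) (s t : ZMod 12 → ℤ) (k l : ℕ) :
    thetaSeries c s k * thetaSeries d t l =
      binaryTheta c d (fun a b => s a * t b) (fun x y => x ^ k * y ^ l) := by
  rw [thetaSeries, thetaSeries, indexedSeries.mul (finiteFibers_sq c hc) (finiteFibers_sq d hd),
    binaryTheta]
  congr 1
  funext x
  ring

theorem thetaSeries_neg (c : ℕ) (s : ZMod 12 → ℤ) (k : ℕ) :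
    thetaSeries c (fun a => (-1) ^ k * s (-a)) k = thetaSeries c s k := by
  rw [thetaSeries, thetaSeries]
  conv_rhs => rw [← indexedSeries.comp_injective _ _ neg_injective fun i _ => ⟨-i, neg_neg i⟩]
  congr 1
  · funext x
    simp
  · funext x
    simp only [Function.comp_apply, Int.cast_neg]
    rw [neg_pow x k]
    ring

/-- The summand is odd, so x ↦ -x shows that the series is its own negative. -/
theorem thetaSeries_eq_zero {c : ℕ} (hc : c ≠ 0) (s : ZMod 12 → ℤ) (k : ℕ)
    (h : ∀ a, (-1) ^ k * s (-a) = -1 * s a) : thetaSeries c s k = 0 := by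
  have h1 := thetaSeries_neg c s k
  have h2 : thetaSeries c (fun a => -1 * s a) k = C (-1) * thetaSeries c s k := by
    rw [thetaSeries, thetaSeries, ← indexedSeries.const_mul (finiteFibers_sq c hc)]
    simp only [mul_assoc]
  rw [funext h, h2, map_neg, map_one, neg_one_mul] at h1
  ext n
  have h3 := congrArg (coeff n) h1
  rw [map_neg] at h3
  rw [map_zero]
  omega

theorem intCast_val_emod {m : ℕ} (hm : m ∣ 12) (x : ℤ) :
    ((((x : ZMod 12).val % m : ℕ)) : ℤ) = x % m := by
  rw [Int.natCast_emod, ZMod.val_intCast, Int.emod_emod_of_dvd]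
  exact_mod_cast hm

/-- (x + y)² + (x - y)² = 2x² + 2y², and (x, y) ↦ (x + y, x - y) hits exactly the pairs of equal
parity, where `hs` puts the support. -/
theorem binaryTheta_rotate (c : ℕ) (s : ZMod 12 → ZMod 12 → ℤ) (f : ℤ → ℤ → ℤ)
    (hs : ∀ a b, s a b ≠ 0 → (a + b).val % 2 = 0) :
    binaryTheta c c s f = binaryTheta (2 * c) (2 * c) (fun a b => s (a + b) (a - b))
      (fun x y => f (x + y) (x - y)) := by
  rw [binaryTheta, binaryTheta, ← indexedSeries.comp_injective _ _
    (j := fun x : ℤ × ℤ => (x.1 + x.2, x.1 - x.2))]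
  · congr 1
    · funext x
      zify
      simp only [Function.comp_apply, sq_abs, Nat.cast_add, Nat.cast_mul, Nat.cast_pow,
        Int.natCast_natAbs]
      ring
    · funext x
      simp
  · rintro ⟨x, y⟩ ⟨z, w⟩ h
    simp only [Prod.mk.injEq] at h ⊢
    omega
  · rintro ⟨x, y⟩ h
    have h1 := hs _ _ (left_ne_zero_of_mul h)
    have h2 := intCast_val_emod (m := 2) (by norm_num) (x + y)
    rw [Int.cast_add, h1] at h2
    refine ⟨((x + y) / 2, (x - y) / 2), ?_⟩
    simp only [Prod.mk.injEq]
    omega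

/-- (x + 2y)² + 2(x - y)² = 3x² + 6y², and the image is the lattice of pairs congruent modulo 3. -/
theorem binaryTheta_one_two (s : ZMod 12 → ZMod 12 → ℤ) (f : ℤ → ℤ → ℤ)
    (hs : ∀ a b, s a b ≠ 0 → (a - b).val % 3 = 0) :
    binaryTheta 1 2 s f = binaryTheta 3 6 (fun a b => s (a + 2 * b) (a - b))
      (fun x y => f (x + 2 * y) (x - y)) := by
  rw [binaryTheta, binaryTheta, ← indexedSeries.comp_injective _ _
    (j := fun x : ℤ × ℤ => (x.1 + 2 * x.2, x.1 - x.2))]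
  · congr 1
    · funext x
      zify
      simp only [Function.comp_apply, sq_abs, Nat.cast_add, Nat.cast_mul, Nat.cast_pow,
        Int.natCast_natAbs]
      push_cast
      ring
    · funext x
      simp
  · rintro ⟨x, y⟩ ⟨z, w⟩ h
    simp only [Prod.mk.injEq] at h ⊢
    omega
  · rintro ⟨x, y⟩ h
    have h1 := hs _ _ (left_ne_zero_of_mul h)
    have h2 := intCast_val_emod (m := 3) (by norm_num) (x - y)
    rw [Int.cast_sub, h1] at h2
    refine ⟨((x + 2 * y) / 3, (x - y) / 3), ?_⟩
    simp only [Prod.mk.injEq]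
    omega

/-- The nontrivial character modulo `4`, as a function modulo `12`. -/
def signFour (a : ZMod 12) : ℤ := if a.val % 4 = 1 then 1 else if a.val % 4 = 3 then -1 else 0

/-- The indicator function of a residue class modulo a divisor of `12`. -/
def residueIndicator (m r : ℕ) (a : ZMod 12) : ℤ := if a.val % m = r then 1 else 0

/-- The sign in the pentagonal number theorem: `(-1) ^ n` at `6 * n - 1`. -/
def pentagonalSign (a : ZMod 12) : ℤ := residueIndicator 12 11 a - residueIndicator 12 5 a

/-! ### The determinant identity behind the tenth power -/

section EtaIdentity

local notation "J" => thetaSeries 3 signFour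
local notation "T" => thetaSeries 6 (residueIndicator 2 0)
local notation "U" => thetaSeries 6 (residueIndicator 2 1)
local notation "D(" r ")" => thetaSeries 2 (residueIndicator 6 r) 0
local notation "G(" r "," k ")" => thetaSeries 1 (fun a => signFour a * residueIndicator 6 r a) k

/-- After rotation the weight is (x + y)(x - y) = x² - y², and the sign separates according to which
of x, y is odd. -/
theorem sq_theta_one :
    J 1 ^ 2 = 2 * (U 2 * T 0 - U 0 * T 2) := by
  have hF := finiteFibers_binary (c := 6) (d := 6) (by norm_num) (by norm_num)
  have hsign : ∀ a b : ZMod 12, signFour (a + b) * signFour (a - b) =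
      residueIndicator 2 1 a * residueIndicator 2 0 b
        - residueIndicator 2 0 a * residueIndicator 2 1 b := by decide
  have key : J 1 * J 1 =
      U 2 * T 0 + C (-1) * (U 0 * T 2) + (C (-1) * (T 2 * U 0) + T 0 * U 2) := by
    rw [thetaSeries_mul (by norm_num) (by norm_num), binaryTheta_rotate _ _ _ (by decide)]
    simp only [thetaSeries_mul (c := 6) (d := 6) (by norm_num) (by norm_num), binaryTheta,
      ← indexedSeries.const_mul hF, ← indexedSeries.add hF]
    congr 1
    funext x
    linear_combination (x.1 + x.2) * (x.1 - x.2) * hsign x.1 x.2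
  rw [sq, key, map_neg, map_one]
  ring

theorem pentagonal_sq :
    thetaSeries 1 pentagonalSign 0 ^ 2 = D(5) * D(0) - D(2) * D(3) := by
  have hF := finiteFibers_binary (c := 2) (d := 2) (by norm_num) (by norm_num)
  have hsign : ∀ a b : ZMod 12, pentagonalSign (a + b) * pentagonalSign (a - b) =
      residueIndicator 6 5 a * residueIndicator 6 0 b
        - residueIndicator 6 2 a * residueIndicator 6 3 b := by decide
  have key : thetaSeries 1 pentagonalSign 0 * thetaSeries 1 pentagonalSign 0 =
      D(5) * D(0) + C (-1) * (D(2) * D(3)) := by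
    rw [thetaSeries_mul (by norm_num) (by norm_num), binaryTheta_rotate _ _ _ (by decide)]
    simp only [thetaSeries_mul (c := 2) (d := 2) (by norm_num) (by norm_num), binaryTheta,
      ← indexedSeries.const_mul hF, ← indexedSeries.add hF]
    congr 1
    funext x
    linear_combination hsign x.1 x.2
  rw [sq, key, map_neg, map_one]
  ring

theorem thetaSeries_residue_neg {r r' : ℕ}
    (h : ∀ a, residueIndicator 6 r (-a) = residueIndicator 6 r' a) :
    D(r') = D(r) := by
  have := thetaSeries_neg 2 (residueIndicator 6 r) 0
  simpa [h] using this

theorem signFour_moment_zero : J 0 = 0 :=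
  thetaSeries_eq_zero (by norm_num) _ _ (by decide)

theorem sum_G_mul_D_even (k : ℕ) :
    G(1, k) * D(1) + (G(3, k) * D(3) + G(5, k) * D(5)) = binaryTheta 3 6
      (fun a b => signFour a * residueIndicator 2 0 b) (fun x y => (x + 2 * y) ^ k) := by
  have hF := finiteFibers_binary (c := 1) (d := 2) (by norm_num) (by norm_num)
  have h := binaryTheta_one_two (fun a b => signFour a *
    (residueIndicator 6 1 a * residueIndicator 6 1 b +
      (residueIndicator 6 3 a * residueIndicator 6 3 b +
        residueIndicator 6 5 a * residueIndicator 6 5 b))) (fun x _ => x ^ k) (by decide)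
  have hsign : ∀ a b : ZMod 12, signFour (a + 2 * b) *
    (residueIndicator 6 1 (a + 2 * b) * residueIndicator 6 1 (a - b) +
      (residueIndicator 6 3 (a + 2 * b) * residueIndicator 6 3 (a - b) +
        residueIndicator 6 5 (a + 2 * b) * residueIndicator 6 5 (a - b))) =
      signFour a * residueIndicator 2 0 b := by decide
  simp only [hsign] at h
  rw [← h]
  simp only [thetaSeries_mul (c := 1) (d := 2) (by norm_num) (by norm_num), binaryTheta,
    ← indexedSeries.add hF]
  congr 1
  funext x
  ring

/-- Here x - y is odd, so the new variable b is odd, and `signFour (a + 2 * b)` = -`signFour a` for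
odd a gives the minus sign. -/
theorem sum_G_mul_D_odd (k : ℕ) :
    G(1, k) * D(4) + (G(3, k) * D(0) + G(5, k) * D(2)) = - binaryTheta 3 6
      (fun a b => signFour a * residueIndicator 2 1 b) (fun x y => (x + 2 * y) ^ k) := by
  have hF := finiteFibers_binary (c := 1) (d := 2) (by norm_num) (by norm_num)
  have hF' := finiteFibers_binary (c := 3) (d := 6) (by norm_num) (by norm_num)
  have h := binaryTheta_one_two (fun a b => signFour a *
    (residueIndicator 6 1 a * residueIndicator 6 4 b +
      (residueIndicator 6 3 a * residueIndicator 6 0 b +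
        residueIndicator 6 5 a * residueIndicator 6 2 b))) (fun x _ => x ^ k) (by decide)
  have hsign : ∀ a b : ZMod 12, signFour (a + 2 * b) *
    (residueIndicator 6 1 (a + 2 * b) * residueIndicator 6 4 (a - b) +
      (residueIndicator 6 3 (a + 2 * b) * residueIndicator 6 0 (a - b) +
        residueIndicator 6 5 (a + 2 * b) * residueIndicator 6 2 (a - b))) =
      -1 * (signFour a * residueIndicator 2 1 b) := by decide
  have hneg : -binaryTheta 3 6 (fun a b => signFour a * residueIndicator 2 1 b)
      (fun x y => (x + 2 * y) ^ k) = binaryTheta 3 6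
        (fun a b => -1 * (signFour a * residueIndicator 2 1 b)) (fun x y => (x + 2 * y) ^ k) := by
    simp only [binaryTheta, mul_assoc (-1 : ℤ)]
    rw [indexedSeries.const_mul hF', map_neg, map_one, neg_one_mul]
  simp only [hsign] at h
  rw [hneg, ← h]
  simp only [thetaSeries_mul (c := 1) (d := 2) (by norm_num) (by norm_num), binaryTheta,
    ← indexedSeries.add hF]
  congr 1
  funext x
  ring

theorem binaryTheta_moment_one (t : ZMod 12 → ℤ) (h1 : thetaSeries 6 t 1 = 0) :
    binaryTheta 3 6 (fun a b => signFour a * t b) (fun x y => (x + 2 * y) ^ 1) =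
      J 1 * thetaSeries 6 t 0 := by
  have hF := finiteFibers_binary (c := 3) (d := 6) (by norm_num) (by norm_num)
  have : J 1 * thetaSeries 6 t 0 = J 1 * thetaSeries 6 t 0 + C 2 * (J 0 * thetaSeries 6 t 1) := by
    rw [h1]
    ring
  rw [this]
  simp only [thetaSeries_mul (c := 3) (d := 6) (by norm_num) (by norm_num), binaryTheta,
    ← indexedSeries.const_mul hF, ← indexedSeries.add hF]
  congr 1
  funext x
  ring

/-- Expand the cube: the terms with the first moment of t and with the zeroth moment of `signFour`
vanish. -/
theorem binaryTheta_moment_three (t : ZMod 12 → ℤ) (h1 : thetaSeries 6 t 1 = 0) :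
    binaryTheta 3 6 (fun a b => signFour a * t b) (fun x y => (x + 2 * y) ^ 3) =
      J 3 * thetaSeries 6 t 0 + 12 * (J 1 * thetaSeries 6 t 2) := by
  have hF := finiteFibers_binary (c := 3) (d := 6) (by norm_num) (by norm_num)
  have : J 3 * thetaSeries 6 t 0 + 12 * (J 1 * thetaSeries 6 t 2) =
      J 3 * thetaSeries 6 t 0 + (C 12 * (J 1 * thetaSeries 6 t 2) +
        (C 6 * (J 2 * thetaSeries 6 t 1) + C 8 * (J 0 * thetaSeries 6 t 3))) := by
    rw [h1, signFour_moment_zero, show C (12 : ℤ) = (12 : ℤ⟦X⟧) from map_ofNat _ 12]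
    ring
  rw [this]
  simp only [thetaSeries_mul (c := 3) (d := 6) (by norm_num) (by norm_num), binaryTheta,
    ← indexedSeries.const_mul hF, ← indexedSeries.add hF]
  congr 1
  funext x
  ring

/-- A determinant form of the identity for the tenth power of the eta function. -/
theorem theta_fourth_power :
    6 * J 1 ^ 4 = thetaSeries 1 pentagonalSign 0 ^ 2 *
      (G(3, 1) * (G(1, 3) + G(5, 3)) - (G(1, 1) + G(5, 1)) * G(3, 3)) := by
  have hT : T 1 = 0 := thetaSeries_eq_zero (by norm_num) _ _ (by decide)
  have hU : U 1 = 0 := thetaSeries_eq_zero (by norm_num) _ _ (by decide)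
  have hD1 : D(1) = D(5) := thetaSeries_residue_neg (by decide)
  have hD4 : D(4) = D(2) := thetaSeries_residue_neg (by decide)
  have e1 := sum_G_mul_D_even 1
  have e3 := sum_G_mul_D_even 3
  have o1 := sum_G_mul_D_odd 1
  have o3 := sum_G_mul_D_odd 3
  rw [binaryTheta_moment_one _ hT] at e1
  rw [binaryTheta_moment_three _ hT] at e3
  rw [binaryTheta_moment_one _ hU] at o1
  rw [binaryTheta_moment_three _ hU] at o3
  have hsq := sq_theta_one
  rw [hD1] at e1 e3
  rw [hD4] at o1 o3
  -- The relations `e1`, `o1`, `e3`, `o3` are a matrix product (G)(D) = (JT, JU) with det D = E² by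
  -- `pentagonal_sq`. In the determinant of the right-hand side J 3 cancels and `sq_theta_one`
  -- applies.
  have h1 : 6 * J 1 ^ 4 = (J 1 * T 0) * (J 3 * U 0 + 12 * (J 1 * U 2))
      - (J 3 * T 0 + 12 * (J 1 * T 2)) * (J 1 * U 0) := by
    linear_combination 6 * J 1 ^ 2 * hsq
  rw [h1, pentagonal_sq, ← neg_neg (J 3 * U 0 + 12 * (J 1 * U 2)), ← o3, ← neg_neg (J 1 * U 0),
    ← o1, ← e1, ← e3]
  ring

end EtaIdentity

theorem coeff_thetaSeries_one_mul_eq_zero (s t : ZMod 12 → ℤ) (k l : ℕ) {n : ℕ}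
    (hn : ∀ x y : ℕ, n ≠ x ^ 2 + y ^ 2) :
    coeff n (thetaSeries 1 s k * thetaSeries 1 t l) = 0 := by
  rw [thetaSeries_mul one_ne_zero one_ne_zero]
  refine indexedSeries.coeff_eq_zero _ fun x hx => hn x.1.natAbs x.2.natAbs ?_
  simpa using hx.symm

/-! ### Passage to the limit: Jacobi's identity -/

theorem X_pow_dvd_eulerProd_sub {m n : ℕ} (h : n ≤ m) :
    (X : ℤ⟦X⟧) ^ (n + 1) ∣ eulerProd X m - eulerProd X n := by
  induction m, h using Nat.le_induction with
  | base => simp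
  | succ m hm ih =>
    rw [eulerProd_succ, show eulerProd (X : ℤ⟦X⟧) m * (1 - X ^ (m + 1)) - eulerProd X n =
      (eulerProd X m - eulerProd X n) - X ^ (m + 1) * eulerProd X m by ring]
    exact dvd_sub ih (Dvd.dvd.mul_right (pow_dvd_pow _ (by omega)) _)

theorem X_pow_dvd_pentagonalSeries_sub (n : ℕ) :
    (X : ℤ⟦X⟧) ^ (n + 1) ∣ pentagonalSeries ℤ - eulerProd X n := by
  rw [X_pow_dvd_iff]
  intro m hm
  obtain ⟨s, hs⟩ := Filter.eventually_atTop.mp (coeff_prod_one_sub_X_pow_eventually_eq ℤ m)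
  obtain ⟨K, hK⟩ := s.exists_nat_subset_range
  have h1 := hs (Finset.range (max K n)) (hK.trans (Finset.range_mono (le_max_left _ _)))
  have h2 := X_pow_dvd_iff.mp (X_pow_dvd_eulerProd_sub (le_max_right K n)) m hm
  rw [map_sub, ← h1]
  rwa [map_sub] at h2

/-- The Gaussian binomial tends X-adically to 1/f as both m and k grow. Multiplying by the unit f
lets the division-free quotient formula be used. -/
theorem X_pow_dvd_gaussBinom_mul_sub_one {m k r : ℕ} (hm : r ≤ m) (hk : r ≤ k) :
    (X : ℤ⟦X⟧) ^ (r + 1) ∣ gaussBinom X (m + k) k * pentagonalSeries ℤ - 1 := by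
  have hdvd : ∀ {n}, r ≤ n → (X : ℤ⟦X⟧) ^ (r + 1) ∣ pentagonalSeries ℤ - eulerProd X n :=
    fun h => (pow_dvd_pow _ (by omega)).trans (X_pow_dvd_pentagonalSeries_sub _)
  have hunit : IsUnit (pentagonalSeries ℤ) := by
    rw [PowerSeries.isUnit_iff_constantCoeff]
    have h := X_pow_dvd_iff.mp (X_pow_dvd_pentagonalSeries_sub 0) 0 (by norm_num)
    simp only [eulerProd, Finset.range_zero, Finset.prod_empty, map_sub,
      coeff_zero_eq_constantCoeff, map_one, sub_eq_zero] at h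
    rw [h]
    exact isUnit_one
  rw [← hunit.dvd_mul_left]
  have key := gaussBinom_mul_eulerProd (X : ℤ⟦X⟧) m k
  set f := pentagonalSeries ℤ
  have e : f * (gaussBinom X (m + k) k * f - 1) =
      gaussBinom X (m + k) k * f * (f - eulerProd X k) +
      gaussBinom X (m + k) k * eulerProd X k * (f - eulerProd X m) -
      (f - eulerProd X (m + k)) := by
    linear_combination key
  rw [e]
  exact dvd_sub (dvd_add (Dvd.dvd.mul_left (hdvd hk) _) (Dvd.dvd.mul_left (hdvd hm) _))
    (hdvd (by omega))

/-- The triangular number `m * (m - 1) / 2` of an integer `m`. -/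
def triangular (m : ℤ) : ℕ := (m * (m - 1) / 2).toNat

theorem two_mul_triangular (m : ℤ) : 2 * (triangular m : ℤ) = m * (m - 1) := by
  have h1 : 2 ∣ m * (m - 1) := by
    have := Int.even_mul_pred_self m
    exact this.two_dvd
  have h2 : 0 ≤ m * (m - 1) := by
    rcases le_or_gt m 0 with h | h <;> nlinarith
  rw [triangular]
  omega

theorem le_triangular (m : ℤ) : m - 1 ≤ triangular m ∧ -m ≤ triangular m := by
  have h := two_mul_triangular m
  constructor
  · rcases le_or_gt m 1 with h1 | h1
    · have : (0 : ℤ) ≤ triangular m := Int.natCast_nonneg _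
      omega
    · nlinarith
  · rcases le_or_gt 0 m with h1 | h1
    · have : (0 : ℤ) ≤ triangular m := Int.natCast_nonneg _
      omega
    · nlinarith

theorem finiteFibers_triangular : FiniteFibers triangular := by
  intro n
  refine (Set.finite_Icc (-(n : ℤ)) (n + 1)).subset fun m hm => ?_
  simp only [Set.mem_ofPred_eq, Set.mem_Icc] at hm ⊢
  have := le_triangular m
  omega

theorem signFour_intCast (x : ℤ) :
    signFour (x : ZMod 12) = if x % 4 = 1 then 1 else if x % 4 = 3 then -1 else 0 := by
  have h := intCast_val_emod (m := 4) (by norm_num) x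
  rw [signFour]
  split_ifs <;> omega

theorem sum_gaussBinom_triangular (N : ℕ) :
    ∑ k ∈ Finset.range (2 * N + 2),
        C (signFour ((2 * ((k : ℤ) - N) - 1 : ℤ) : ZMod 12) * (2 * ((k : ℤ) - N) - 1)) *
        (X ^ triangular (k - N) * gaussBinom X (2 * N + 1) k) =
      (2 : ℤ⟦X⟧) * eulerProd X N ^ 2 := by
  have h := sum_gaussBinom_odd (X : ℤ⟦X⟧) N
  have hX : (X : ℤ⟦X⟧) ^ (N + N.choose 2 + N * N) ≠ 0 := pow_ne_zero _ X_ne_zero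
  apply mul_left_cancel₀ hX
  have hsq : ((-1 : ℤ⟦X⟧) ^ N) ^ 2 = 1 := by rw [← pow_mul, mul_comm, pow_mul]; simp
  have h' : (X : ℤ⟦X⟧) ^ (N + N.choose 2 + N * N) * (2 * eulerProd X N ^ 2) =
      -(-1) ^ N * (-2 * (-1) ^ N * X ^ (N + N.choose 2 + N * N) * eulerProd X N ^ 2) := by
    linear_combination -2 * X ^ (N + N.choose 2 + N * N) * eulerProd (X : ℤ⟦X⟧) N ^ 2 * hsq
  rw [h', ← h, Finset.mul_sum, Finset.mul_sum]
  refine Finset.sum_congr rfl fun k hk => ?_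
  have hk := Finset.mem_range.mp hk
  -- Completing the square about k = N leaves a triangular number plus a constant, the power of X
  -- being cancelled.
  have hexp : N + N.choose 2 + N * N + triangular (k - N) =
      k.choose 2 + N * (2 * N + 1 - k) := by
    have t1 := two_mul_triangular (k - N)
    have c1 : ∀ n : ℕ, 2 * (n.choose 2 : ℤ) = n * (n - 1) := by
      intro n
      induction n with
      | zero => simp
      | succ n ih =>
        rw [Nat.choose_succ_succ' n 1, Nat.choose_one_right]
        push_cast
        linarith
    have := c1 N
    have := c1 k
    zify [show k ≤ 2 * N + 1 by omega]
    linarith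
  have hsign : C (signFour ((2 * ((k : ℤ) - N) - 1 : ℤ) : ZMod 12)) =
      -(-1 : ℤ⟦X⟧) ^ N * (-1) ^ k := by
    rw [signFour_intCast, neg_mul, ← pow_add]
    rcases Nat.even_or_odd (N + k) with h | h
    · rw [h.neg_one_pow, if_neg (by obtain ⟨r, hr⟩ := h; omega),
        if_pos (by obtain ⟨r, hr⟩ := h; omega)]
      simp
    · rw [h.neg_one_pow, if_pos (by obtain ⟨r, hr⟩ := h; omega)]
      simp
  rw [map_mul, hsign, ← hexp, pow_add]
  have : C (2 * ((k : ℤ) - N) - 1) = (2 * (k : ℤ⟦X⟧) - (2 * N + 1)) := by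
    simp
    ring
  rw [this]
  ring

/-- Jacobi's identity for the cube of the Euler product. -/
theorem two_mul_pentagonalSeries_cube :
    2 * pentagonalSeries ℤ ^ 3 = indexedSeries triangular
      (fun m => signFour ((2 * m - 1 : ℤ) : ZMod 12) * (2 * m - 1)) := by
  set w : ℤ → ℤ := fun m => signFour ((2 * m - 1 : ℤ) : ZMod 12) * (2 * m - 1)
  ext N
  have hfin := sum_gaussBinom_triangular N
  set f := pentagonalSeries ℤ
  have hdvd : (X : ℤ⟦X⟧) ^ (N + 1) ∣ 2 * f ^ 3 -
      ∑ k ∈ Finset.range (2 * N + 2), C (w ((k : ℤ) - N)) * X ^ triangular (k - N) := by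
    have h1 : (X : ℤ⟦X⟧) ^ (N + 1) ∣ 2 * f * (f + eulerProd X N) * (f - eulerProd X N) :=
      Dvd.dvd.mul_left (X_pow_dvd_pentagonalSeries_sub N) _
    have h2 : (X : ℤ⟦X⟧) ^ (N + 1) ∣ ∑ k ∈ Finset.range (2 * N + 2),
        C (w ((k : ℤ) - N)) * (X ^ triangular (k - N) * (gaussBinom X (2 * N + 1) k * f - 1)) := by
      refine Finset.dvd_sum fun k hk => Dvd.dvd.mul_left ?_ _
      have hk := Finset.mem_range.mp hk
      -- The precision is poor for k near either end, but there `triangular (k - N)` supplies the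
      -- missing powers of X.
      have h3 := X_pow_dvd_gaussBinom_mul_sub_one (min_le_left (2 * N + 1 - k) k)
        (min_le_right (2 * N + 1 - k) k)
      rw [Nat.sub_add_cancel (by omega)] at h3
      refine (pow_dvd_pow _ ?_).trans ((pow_add (X : ℤ⟦X⟧) _ _).dvd.trans (mul_dvd_mul_left _ h3))
      have := le_triangular (k - N)
      omega
    have e : 2 * f ^ 3 - ∑ k ∈ Finset.range (2 * N + 2), C (w ((k : ℤ) - N)) *
        X ^ triangular (k - N) = 2 * f * (f + eulerProd X N) * (f - eulerProd X N) +
        ∑ k ∈ Finset.range (2 * N + 2),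
        C (w ((k : ℤ) - N)) * (X ^ triangular (k - N) * (gaussBinom X (2 * N + 1) k * f - 1)) := by
      have : ∑ k ∈ Finset.range (2 * N + 2), C (w ((k : ℤ) - N)) * (X ^ triangular (k - N) *
          (gaussBinom X (2 * N + 1) k * f - 1)) =
          (∑ k ∈ Finset.range (2 * N + 2), C (w ((k : ℤ) - N)) * (X ^ triangular (k - N) *
            gaussBinom X (2 * N + 1) k)) * f - ∑ k ∈ Finset.range (2 * N + 2),
            C (w ((k : ℤ) - N)) * X ^ triangular (k - N) := by
        rw [Finset.sum_mul, ← Finset.sum_sub_distrib]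
        exact Finset.sum_congr rfl fun k _ => by ring
      rw [this, hfin]
      ring
    rw [e]
    exact dvd_add h1 h2
  have h := X_pow_dvd_iff.mp hdvd N (Nat.lt_succ_self N)
  rw [map_sub, sub_eq_zero] at h
  rw [h, indexedSeries.coeff_eq_sum finiteFibers_triangular, map_sum]
  simp only [coeff_C_mul, coeff_X_pow, mul_ite, mul_one, mul_zero]
  rw [← Finset.sum_filter]
  refine Finset.sum_nbij (fun k : ℕ => (k : ℤ) - N) ?_ ?_ ?_ ?_
  · intro k hk
    simp only [Finset.mem_filter, Set.Finite.mem_toFinset, Set.mem_ofPred_eq] at hk ⊢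
    exact hk.2.symm
  · intro k _ l _ hkl
    simp only at hkl
    omega
  · intro m hm
    simp only [Set.Finite.coe_toFinset, Set.mem_ofPred_eq] at hm
    have := le_triangular m
    refine ⟨(m + N).toNat, ?_, ?_⟩
    · simp only [Finset.coe_filter, Finset.mem_range, Set.mem_ofPred_eq]
      have e : (((m + N).toNat : ℕ) : ℤ) - N = m := by omega
      rw [e]
      omega
    · simp only
      omega
  · intro k _
    rfl

/-! ### The Euler product and its cube as theta series -/

theorem pentagonalSeries_eq_indexedSeries :
    pentagonalSeries ℤ = indexedSeries pentagonal (fun k => (Int.negOnePow k : ℤ)) := by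
  ext n
  by_cases h : n ∈ Set.range pentagonal
  · obtain ⟨k, rfl⟩ := h
    rw [coeff_pentagonalSeries_pentagonal, indexedSeries, coeff_mk]
    have : {i | pentagonal i = pentagonal k} = {k} := by
      ext i
      simp
    rw [this, finsum_mem_singleton, Int.cast_id]
  · rw [coeff_pentagonalSeries_eq_zero _ h, indexedSeries.coeff_eq_zero]
    exact fun i hi => h ⟨i, hi⟩

/-- 24 · k(3k - 1)/2 + 1 = (6k - 1)². -/
theorem X_mul_expand_pentagonalSeries :
    X * expand 24 (by norm_num) (pentagonalSeries ℤ) = thetaSeries 1 pentagonalSign 0 := by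
  rw [pentagonalSeries_eq_indexedSeries]
  have h := indexedSeries.X_pow_mul_expand 1 24 (by norm_num) pentagonal
    (fun k => (Int.negOnePow k : ℤ))
  rw [pow_one] at h
  have hmod : ∀ x : ℤ, pentagonalSign (x : ZMod 12) =
      if x % 12 = 11 then 1 else if x % 12 = 5 then -1 else 0 := by
    intro x
    have h := intCast_val_emod (m := 12) (by norm_num) x
    simp only [pentagonalSign, residueIndicator]
    split_ifs <;> omega
  have hinj : Function.Injective fun k : ℤ => 6 * k - 1 := by
    intro x y h
    simp only at h
    omega
  have hrange : ∀ x : ℤ, pentagonalSign (x : ZMod 12) * x ^ 0 ≠ 0 →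
      x ∈ Set.range fun k : ℤ => 6 * k - 1 := by
    intro x hx
    have h0 := left_ne_zero_of_mul hx
    rw [hmod] at h0
    refine ⟨(x + 1) / 6, ?_⟩
    simp only
    split_ifs at h0 <;> omega
  rw [h, thetaSeries]
  conv_rhs => rw [← indexedSeries.comp_injective _ _ (j := fun k : ℤ => 6 * k - 1) hinj hrange]
  · congr 1
    · funext k
      have := two_mul_natCast_pentagonal k
      zify
      simp only [Function.comp_apply, sq_abs, Nat.cast_mul, Nat.cast_pow, Int.natCast_natAbs]
      push_cast
      linear_combination 12 * this
    · funext k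
      simp only [Function.comp_apply, pow_zero, mul_one, hmod]
      rcases Int.even_or_odd k with h | h
      · rw [Int.negOnePow_even _ h, if_pos (by obtain ⟨r, hr⟩ := h; omega)]
        rfl
      · rw [Int.negOnePow_odd _ h, if_neg (by obtain ⟨r, hr⟩ := h; omega),
          if_pos (by obtain ⟨r, hr⟩ := h; omega)]
        rfl

/-- 24 · k(k - 1)/2 + 3 = 3(2k - 1)². The factor 2 arises because k and 1 - k give equal terms. -/
theorem thetaSeries_signFour_one :
    thetaSeries 3 signFour 1 = 2 * thetaSeries 1 pentagonalSign 0 ^ 3 := by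
  rw [← X_mul_expand_pentagonalSeries, mul_pow, ← map_pow,
    show 2 * (X ^ 3 * expand 24 (by norm_num) (pentagonalSeries ℤ ^ 3)) =
      X ^ 3 * expand 24 (by norm_num) (2 * pentagonalSeries ℤ ^ 3) by
        rw [map_mul, map_ofNat]; ring,
    two_mul_pentagonalSeries_cube, indexedSeries.X_pow_mul_expand, thetaSeries,
    ← indexedSeries.comp_injective _ _ (j := fun k : ℤ => 2 * k - 1)]
  · congr 1
    · funext k
      have := two_mul_triangular k
      zify
      simp only [Function.comp_apply, sq_abs, Nat.cast_mul, Nat.cast_pow, Int.natCast_natAbs]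
      push_cast
      linear_combination -12 * this
    · funext k
      simp
  · intro x y h
    simp only at h
    omega
  · intro x hx
    have h0 := left_ne_zero_of_mul hx
    rw [signFour_intCast] at h0
    refine ⟨(x + 1) / 2, ?_⟩
    simp only
    split_ifs at h0 <;> omega

/-- The coefficients of the tenth power of the Euler product vanish away from sums of two
squares. -/
theorem coeff_pentagonalSeries_pow_ten_eq_zero {m : ℕ}
    (hm : ∀ x y : ℕ, 24 * m + 10 ≠ x ^ 2 + y ^ 2) :
    coeff m (pentagonalSeries ℤ ^ 10) = 0 := by
  have h := theta_fourth_power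
  rw [thetaSeries_signFour_one] at h
  set E := thetaSeries 1 pentagonalSign 0 with hE
  have hE0 : E ^ 2 ≠ 0 := by
    refine pow_ne_zero 2 fun h0 => ?_
    have h1 : coeff 1 E = 1 := by
      rw [hE, ← X_mul_expand_pentagonalSeries, show (1 : ℕ) = 0 + 1 from rfl, coeff_succ_X_mul,
        coeff_zero_eq_constantCoeff, constantCoeff_expand, ← coeff_zero_eq_constantCoeff_apply]
      exact (coeff_pentagonalSeries_pentagonal ℤ 0).trans (by simp)
    rw [h0] at h1
    simp at h1
  -- 6 · (2E³)⁴ = 96 E¹², and E² cancels.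
  have h10 : C 96 * E ^ 10 = _ := mul_left_cancel₀ hE0 (Eq.trans (by
    rw [show C (96 : ℤ) = (96 : ℤ⟦X⟧) from map_ofNat _ 96]; ring) h)
  have hc := congrArg (coeff (24 * m + 10)) h10
  rw [mul_add, add_mul, map_sub, map_add, map_add] at hc
  simp only [coeff_thetaSeries_one_mul_eq_zero _ _ _ _ hm] at hc
  rw [coeff_C_mul, hE, ← X_mul_expand_pentagonalSeries, mul_pow, ← map_pow, coeff_X_pow_mul,
    coeff_expand_mul] at hc
  omega

/-! ### Reduction modulo 11 -/

theorem map_pentagonalSeries (R : Type*) [CommRing R] :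
    PowerSeries.map (Int.castRingHom R) (pentagonalSeries ℤ) = pentagonalSeries R := by
  ext n
  rw [coeff_map]
  by_cases h : n ∈ Set.range pentagonal
  · obtain ⟨k, rfl⟩ := h
    rw [coeff_pentagonalSeries_pentagonal, coeff_pentagonalSeries_pentagonal]
    simp
  · rw [coeff_pentagonalSeries_eq_zero _ h, coeff_pentagonalSeries_eq_zero _ h, map_zero]

theorem geom_sum_eq_one_sub_pow {R : Type*} [CommRing R] [IsDomain R] (p : ℕ) [Fact p.Prime]
    [CharP R p] {x : R} (hx : 1 - x ≠ 0) :
    ∑ j ∈ Finset.range p, x ^ j = (1 - x) ^ (p - 1) := by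
  apply mul_right_cancel₀ hx
  rw [geom_sum_mul_neg, ← pow_succ, Nat.sub_add_cancel (Fact.out : p.Prime).one_le,
    sub_pow_char, one_pow]

open scoped PowerSeries.WithPiTopology in
/-- Modulo a prime `p`, the generating function of `p`-regular partitions is the `(p - 1)`-st power
of the Euler product. -/
theorem powerSeriesMk_card_restricted_prime (p : ℕ) [hp : Fact p.Prime] :
    PowerSeries.mk (fun n => ((Nat.Partition.restricted n (¬ p ∣ ·)).card : ZMod p)) =
      pentagonalSeries (ZMod p) ^ (p - 1) := by
  let _ : TopologicalSpace (ZMod p) := ⊥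
  have _ : DiscreteTopology (ZMod p) := ⟨rfl⟩
  have : CharP (ZMod p)⟦X⟧ p := charP_of_injective_algebraMap (R := ZMod p)
    (FaithfulSMul.algebraMap_injective _ _) p
  -- Glaisher: p-regular partitions are equinumerous with those repeating each part fewer than p
  -- times, whose generating function is a product of geometric sums.
  rw [Nat.Partition.powerSeriesMk_card_restricted_eq_powerSeriesMk_card_countRestricted _
    hp.out.pos, Nat.Partition.powerSeriesMk_card_countRestricted_eq_tprod _ hp.out.pos]
  have h := (WithPiTopology.hasProd_one_sub_X_pow (ZMod p)).pow (p - 1)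
  rw [← h.tprod_eq]
  refine tprod_congr fun i => ?_
  simp only [pow_mul]
  refine geom_sum_eq_one_sub_pow p fun h0 => ?_
  have := congrArg constantCoeff h0
  simp at this

theorem card_restricted_eleven_modEq {m : ℕ} (hm : ∀ x y : ℕ, 24 * m + 10 ≠ x ^ 2 + y ^ 2) :
    (Nat.Partition.restricted m (¬ 11 ∣ ·)).card ≡ 0 [MOD 11] := by
  have : Fact (Nat.Prime 11) := ⟨by norm_num⟩
  have h := congrArg (coeff m) (powerSeriesMk_card_restricted_prime 11)
  rw [coeff_mk, ← map_pentagonalSeries, ← map_pow, coeff_map,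
    coeff_pentagonalSeries_pow_ten_eq_zero hm, map_zero] at h
  rw [← ZMod.natCast_eq_natCast_iff, h, Nat.cast_zero]

/-! ### Sums of two squares and the main theorem -/

/-- The p-adic valuation is 2 v(a) + 1, which is odd. -/
theorem sq_mul_prime_mul_ne_sq_add_sq {p a u : ℕ} (hp : p.Prime) (hp3 : p % 4 = 3) (ha : a ≠ 0)
    (hu : ¬ p ∣ u) (x y : ℕ) : a ^ 2 * p * u ≠ x ^ 2 + y ^ 2 := by
  intro h
  have : Fact p.Prime := ⟨hp⟩
  have hu0 : u ≠ 0 := fun h => hu (h ▸ dvd_zero p)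
  have h1 := Nat.eq_sq_add_sq_iff.mp ⟨x, y, h⟩ p (by
    rw [Nat.mem_primeFactors]
    exact ⟨hp, ⟨a ^ 2 * u, by ring⟩, by simp [ha, hu0, hp.ne_zero]⟩) hp3
  rw [padicValNat.mul (by simp [ha, hp.ne_zero]) hu0, padicValNat.mul (by simp [ha]) hp.ne_zero,
    padicValNat.pow _ , padicValNat.self hp.one_lt, padicValNat.eq_zero_of_not_dvd hu] at h1
  obtain ⟨r, hr⟩ := h1
  omega

theorem Nat.Prime.sq_modEq_one_twelve {p : ℕ} (hp : p.Prime) (h5 : 5 ≤ p) :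
    (p : ℤ) ^ 2 ≡ 1 [ZMOD 12] := by
  have h2 : ¬ 2 ∣ p := fun h => by
    have := (Nat.prime_dvd_prime_iff_eq Nat.prime_two hp).mp h
    omega
  have h3 : ¬ 3 ∣ p := fun h => by
    have := (Nat.prime_dvd_prime_iff_eq Nat.prime_three hp).mp h
    omega
  have h : (p : ℤ) % 12 = 1 ∨ (p : ℤ) % 12 = 5 ∨ (p : ℤ) % 12 = 7 ∨ (p : ℤ) % 12 = 11 := by omega
  rw [Int.ModEq, sq, Int.mul_emod]
  rcases h with h | h | h | h <;> rw [h] <;> rfl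

theorem theorem1p2 (α n : ℕ) (p : Fin (α + 1) → ℕ)
    (hprime : ∀ i, (p i).Prime) (hge : ∀ i, 5 ≤ p i) (hmod : ∀ i, p i ≡ 3 [MOD 4])
    (j : ℤ) (hj : ¬ j ≡ 0 [ZMOD (p (Fin.last α) : ℤ)]) :
    (12 : ℤ) ∣ (∏ i : Fin α, (p i.castSucc : ℤ) ^ 2) * (p (Fin.last α) : ℤ) *
        (12 * j + 5 * (p (Fin.last α) : ℤ)) - 5 ∧
    regularPartitionCount 11
      ((∏ i : Fin (α + 1), (p i : ℤ) ^ 2) * (n : ℤ) +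
        ((∏ i : Fin α, (p i.castSucc : ℤ) ^ 2) * (p (Fin.last α) : ℤ) *
          (12 * j + 5 * (p (Fin.last α) : ℤ)) - 5) / 12) ≡ 0 [MOD 11] := by
  have hone : (∏ i : Fin α, (p i.castSucc : ℤ) ^ 2) ≡ 1 [ZMOD 12] :=
    Finset.prod_induction _ (fun x : ℤ => x ≡ 1 [ZMOD 12])
      (fun a b ha hb => by simpa using ha.mul hb) rfl fun i _ => (hprime _).sq_modEq_one_twelve (hge _)
  have hlast := (hprime (Fin.last α)).sq_modEq_one_twelve (hge _)
  rw [Fin.prod_univ_castSucc]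
  rw [Finset.prod_pow] at hone ⊢
  set A : ℤ := ∏ i : Fin α, (p i.castSucc : ℤ)
  set P := p (Fin.last α)
  have hA : A ≠ 0 := Finset.prod_ne_zero_iff.mpr fun i _ => by
    exact_mod_cast (hprime i.castSucc).ne_zero
  have hP := hprime (Fin.last α)
  have hdvd : (12 : ℤ) ∣ A ^ 2 * P * (12 * j + 5 * P) - 5 := by
    have h1 := (hone.mul hlast).symm.dvd
    have h2 : A ^ 2 * P * (12 * j + 5 * P) - 5 =
        12 * (A ^ 2 * P * j) + 5 * (A ^ 2 * (P : ℤ) ^ 2 - 1 * 1) := by ring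
    rw [h2]
    exact dvd_add (dvd_mul_right _ _) (Dvd.dvd.mul_left h1 _)
  refine ⟨hdvd, ?_⟩
  obtain ⟨c, hc⟩ := hdvd
  rw [hc, Int.mul_ediv_cancel_left _ (by norm_num), regularPartitionCount]
  split_ifs with hpos
  · refine card_restricted_eleven_modEq fun x y hxy => ?_
    set m := A ^ 2 * (P : ℤ) ^ 2 * n + c
    -- The cofactor in 24m + 10 = A²Pu. It is congruent to 24j modulo P, and P ≥ 5 is prime to 24.
    set u : ℤ := 2 * (12 * (P * n + j) + 5 * P) with hu
    have hm : ((24 * m.toNat + 10 : ℕ) : ℤ) = A ^ 2 * P * u := by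
      push_cast
      rw [Int.toNat_of_nonneg hpos]
      linear_combination -2 * hc
    have hnat : 24 * m.toNat + 10 = A.natAbs ^ 2 * P * u.natAbs := by
      have := congrArg Int.natAbs hm
      rwa [Int.natAbs_natCast, Int.natAbs_mul, Int.natAbs_mul, Int.natAbs_pow,
        Int.natAbs_natCast] at this
    refine sq_mul_prime_mul_ne_sq_add_sq hP (hmod _) (Int.natAbs_ne_zero.mpr hA) (fun hdu => ?_) x y
      (hnat ▸ hxy)
    have h1 : (P : ℤ) ∣ u := Int.natCast_dvd.mpr hdu
    have h2 : (P : ℤ) ∣ 24 * j := by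
      have : 24 * j = u - P * (24 * n + 10) := by rw [hu]; ring
      rw [this]
      exact dvd_sub h1 (dvd_mul_right _ _)
    rcases (Nat.prime_iff_prime_int.mp hP).dvd_or_dvd h2 with h3 | h3
    · have h4 : P ∣ 2 ^ 3 * 3 := by exact_mod_cast h3
      have h5 := hge (Fin.last α)
      rcases hP.dvd_mul.mp h4 with h6 | h6
      · have := Nat.le_of_dvd (by norm_num) (hP.dvd_of_dvd_pow h6)
        omega
      · have := Nat.le_of_dvd (by norm_num) h6
        omega
    · exact hj (Int.modEq_zero_iff_dvd.mpr h3)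
  -- A negative j can make the argument negative; the count is then 0 by convention.
  · rfl
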